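/- Write $[n]=\{1,\dots,n\}$. A code is a set $\mathcal C$ of subsets of $[n]$ for some $n$; its elements, the codewords, are written without braces and commas, so $45$ means $\{4,5\}$. A code $\mathcal C\subseteq 2^{[n]}$ is convex if for some $d$ there are a convex open set $X\subseteq\mathbb R^d$ and convex open sets $U_1,\dots,U_n\subseteq X$ such that $$\mathcal C=\Big\{\sigma\subseteq[n]\ :\ \bigcap_{i\in\sigma}U_i\setminus\bigcup_{j\notin\sigma}U_j\neq\emptyset\Big\},$$ where the empty intersection is $X$. A trunk in $\mathcal C$ is either $\emptyset$ or a set of the form $\{c\in\mathcal C:\sigma\subseteq c\}$ with $\sigma\subseteq[n]$. A function $f:\mathcal C\to\mathcal D$ between codes is a morphism if the preimage of every trunk in $\mathcal D$ is a trunk in $\mathcal C$, and an isomorphism if it has an inverse function that is also a morphism. A code $\mathcal C$ is minimally non-convex if $\mathcal C$ is not convex, but every code that is the image of $\mathcal C$ under a morphism and is not isomorphic to $\mathcal C$ is convex, and every trunk in $\mathcal C$ other than $\mathcal C$ itself is convex. Let $\Delta(\mathcal C)$ be the simplicial complex of all subsets of codewords of $\mathcal C$. The code $\mathcal C$ has a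 local obstruction of the first kind (respectively, of the second kind) at $\sigma\in\Delta(\mathcal C)$ if $\sigma\notin\mathcal C$ and the link of $\sigma$ in $\Delta(\mathcal C)$ is not contractible (respectively, not collapsible, i.e. cannot be reduced to a single vertex by a finite sequence of simplicial collapses). Theorem. The code $\mathcal C_0=\{3456,\,123,\,145,\,256,\,45,\,56,\,1,\,2,\,3,\,\emptyset\}\subseteq 2^{[6]}$ is minimally non-convex, and it has no local obstructions of the first or second kind. -/

import Mathlib

namespace NeuralCode

/-- A combinatorial code on `n` neurons: a subset of the Boolean lattice of subsets of the neuron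
set. Elements of the code are its codewords. -/
abbrev Code (n : ℕ) := Set (Finset (Fin n))

/-! ### Convex codes -/

/-- The code of the sets `U i` in the ambient set `X`. The empty intersection is `X`. -/
def codeOf {n : ℕ} {E : Type*} (U : Fin n → Set E) (X : Set E) : Code n :=
  {σ | ((X ∩ ⋂ i ∈ σ, U i) \ ⋃ j ∉ σ, U j).Nonempty}

/-- A code is convex if it is the code of convex open subsets of a convex open set
in some Euclidean space. -/
def IsConvex {n : ℕ} (C : Code n) : Prop :=
  ∃ (d : ℕ) (X : Set (EuclideanSpace ℝ (Fin d))) (U : Fin n → Set (EuclideanSpace ℝ (Fin d))),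
    IsOpen X ∧ Convex ℝ X ∧ (∀ i, U i ⊆ X ∧ IsOpen (U i) ∧ Convex ℝ (U i)) ∧ codeOf U X = C

/-! ### Trunks and morphisms -/

/-- The trunk of `σ` in `C`: all codewords that contain `σ`. -/
def trunk {n : ℕ} (C : Code n) (σ : Finset (Fin n)) : Set C :=
  {c | σ ⊆ c.1}

/-- A trunk in `C` is the empty set or the trunk of some set of neurons. -/
def IsTrunk {n : ℕ} {C : Code n} (T : Set C) : Prop :=
  T = ∅ ∨ ∃ σ : Finset (Fin n), T = trunk C σ

/-- A function between codes is a morphism if preimages of trunks are trunks. -/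
def IsMorphism {n m : ℕ} {C : Code n} {D : Code m} (f : C → D) : Prop :=
  ∀ T : Set D, IsTrunk T → IsTrunk (f ⁻¹' T)

/-- Two codes are isomorphic if there is a morphism between them that has an inverse function
which is also a morphism. -/
def Isomorphic {n m : ℕ} (C : Code n) (D : Code m) : Prop :=
  ∃ (f : C → D) (g : D → C), IsMorphism f ∧ IsMorphism g ∧
    Function.LeftInverse g f ∧ Function.RightInverse g f

/-- The image of a code under a function to another code, as a code. -/
def imageCode {n m : ℕ} {C : Code n} {D : Code m} (f : C → D) : Code m :=
  Subtype.val '' Set.range f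

/-- A code is minimally non-convex if it is not convex, but all its images under morphisms that
are not isomorphic to it, and all its proper trunks, are convex. -/
def IsMinimallyNonConvex {n : ℕ} (C : Code n) : Prop :=
  ¬ IsConvex C ∧
  (∀ (m : ℕ) (D : Code m) (f : C → D), IsMorphism f →
    ¬ Isomorphic C (imageCode f) → IsConvex (imageCode f)) ∧
  (∀ T : Set C, IsTrunk T → T ≠ Set.univ → IsConvex (Subtype.val '' T : Code n))

/-! ### Simplicial complexes and local obstructions

A simplicial complex on the neurons is a down-closed family of sets of neurons. The empty set counts
as a face. -/

/-- The simplicial complex of a code: its down-closure. -/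
def complex {n : ℕ} (C : Code n) : LowerSet (Finset (Fin n)) :=
  lowerClosure C

/-- The link of `σ` in the complex `K`. -/
def link {n : ℕ} (K : LowerSet (Finset (Fin n))) (σ : Finset (Fin n)) :
    LowerSet (Finset (Fin n)) where
  carrier := {τ | Disjoint τ σ ∧ τ ∪ σ ∈ K}
  lower' := fun _ _ hba h =>
    ⟨h.1.mono_left hba, K.lower (Finset.union_subset_union_left hba) h.2⟩

/-- The geometric realization of a complex with vertices among `Fin n`: the union, over the faces,
of the corresponding faces of the standard simplex. -/
def realization {n : ℕ} (K : LowerSet (Finset (Fin n))) : Set (Fin n → ℝ) :=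
  {x | x ∈ stdSimplex ℝ (Fin n) ∧ ∃ τ ∈ K, ∀ i ∉ τ, x i = 0}

/-- A complex is contractible if its geometric realization is a contractible space. -/
def IsContractible {n : ℕ} (K : LowerSet (Finset (Fin n))) : Prop :=
  ContractibleSpace (realization K)

/-- `Collapses K L`: the complex `L` arises from `K` by one collapse. That is, some nonempty face `ρ`
is properly contained in a facet `τ` of `K` and in no other facet, and `L` consists of the faces
of `K` that do not contain `ρ`. -/
def Collapses {n : ℕ} (K L : LowerSet (Finset (Fin n))) : Prop :=
  ∃ ρ τ : Finset (Fin n), ρ.Nonempty ∧ ρ ⊂ τ ∧ τ ∈ K ∧ (∀ γ ∈ K, ρ ⊆ γ → γ ⊆ τ) ∧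
    (L : Set (Finset (Fin n))) = {γ | γ ∈ K ∧ ¬ ρ ⊆ γ}

/-- A complex is collapsible if a finite sequence of collapses reduces it to a single vertex. -/
def IsCollapsible {n : ℕ} (K : LowerSet (Finset (Fin n))) : Prop :=
  ∃ v : Fin n, Relation.ReflTransGen Collapses K (LowerSet.Iic {v})

/-- `C` has a local obstruction (of the first kind) at `σ`. -/
def HasLocalObstructionAt {n : ℕ} (C : Code n) (σ : Finset (Fin n)) : Prop :=
  σ ∈ complex C ∧ σ ∉ C ∧ ¬ IsContractible (link (complex C) σ)

/-- `C` has a local obstruction of the second kind at `σ`. -/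
def HasLocalObstructionOfSecondKindAt {n : ℕ} (C : Code n) (σ : Finset (Fin n)) : Prop :=
  σ ∈ complex C ∧ σ ∉ C ∧ ¬ IsCollapsible (link (complex C) σ)

/-- The code `{3456, 123, 145, 256, 45, 56, 1, 2, 3, ∅}` on six neurons. The neurons `1, …, 6` are
represented by the elements `0, …, 5` of `Fin 6`, so that each label is lowered by one. -/
def C₀ : Code 6 :=
  {{2, 3, 4, 5}, {0, 1, 2}, {0, 3, 4}, {1, 4, 5}, {3, 4}, {4, 5}, {0}, {1}, {2}, ∅}

end NeuralCode

namespace NeuralCode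

open Set

/-! ### Sunflowers -/

section Sunflower

variable {E : Type*} [NormedAddCommGroup E] [NormedSpace ℝ E]

/-! Labels here are those of the code, `1` to `6`. In a convex realization the sets of 1, 2, 3 form
a sunflower: any two of them meet exactly in the region of 123. Join a point of the region 145 to a
point of the region 256. The segment lies in the set of 5, which the open sets of 4 and 6 cover, so
by connectedness it meets both at once. That happens only in the region 3456, which lies in the set
of 3 and outside the kernel. But `mem_of_sunflower` says that a point of the third petal between
points of the other two lies in the kernel.

For minimality, a morphism is determined by the preimages of the trunks of single neurons. If every
trunk of a single neuron of the source is such a preimage, the morphism is an isomorphism onto its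
image (`isomorphic_imageCode`). Otherwise some neuron `i` is forgotten, and it suffices to realize
all trunks but that of `i`; this is `AlmostRealizable`. Six explicit arrangements, one for each
neuron, allow only the set of that neuron to fail to be open or convex
(`almostRealizable_of_codeOf`). They handle proper trunks as well
(`AlmostRealizable.isConvex_trunk`).

For local obstructions, 5 is the only intersection of maximal codewords that is not a codeword. At
every other non-codeword face the facets through it share a further vertex, so the link is a cone.
The link at 5 is a triangle with two edges attached, which is contractible and collapsible by
inspection. -/

/-- Suppose `U` and `V` are convex, `V` is open, and `W = U ∩ V`. A linear functional that attains
on the closure of `W` its supremum at a point of `V` attains there its supremum on `U`. -/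
lemma le_of_inter_le {U V : Set E} (hU : Convex ℝ U) (hV : IsOpen V) {f : E →L[ℝ] ℝ} {q : E}
    (hqV : q ∈ V) (hq : q ∈ closure (U ∩ V)) (hf : ∀ w ∈ U ∩ V, f w < f q) {u : E} (hu : u ∈ U) :
    f u ≤ f q := by
  by_contra! hlt
  have hc : ContinuousAt (fun t : ℝ => q + t • (u - q)) 0 := by fun_prop
  have hev : ∀ᶠ t : ℝ in nhds 0, q + t • (u - q) ∈ V :=
    hc.eventually_mem (by simpa using hV.mem_nhds hqV)
  obtain ⟨t, ⟨htV, ht1⟩, ht0⟩ :=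
    (((hev.and (gt_mem_nhds (zero_lt_one' ℝ))).filter_mono nhdsWithin_le_nhds).and
      (self_mem_nhdsWithin : Ioi (0 : ℝ) ∈ nhdsWithin 0 (Ioi 0))).exists
  have ht0 : 0 < t := ht0
  -- The point `q` need not lie in `U`, so the shift towards `u` is applied to points `w` of `U ∩ V`
  -- near `q`; convexity then keeps the shifted point in `U`.
  let z : E → E := fun w => w + t • (u - w)
  have hz : ContinuousAt z q := by fun_prop
  have hzV : ∀ᶠ w in nhds q, z w ∈ V := hz.eventually_mem (hV.mem_nhds htV)
  have hfz : ContinuousAt (fun w => f (z w)) q := by fun_prop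
  have hgt : f q < f (z q) := by
    have : f (z q) = f q + t * (f u - f q) := by simp [z]
    rw [this]
    have := mul_pos ht0 (sub_pos.2 hlt)
    linarith
  have hzf : ∀ᶠ w in nhds q, f q < f (z w) := hfz.eventually (lt_mem_nhds hgt)
  obtain ⟨w, hw, hwV, hwf⟩ := ((mem_closure_iff_frequently.1 hq).and_eventually
    (hzV.and hzf)).exists
  have hzU : z w ∈ U := hU.add_smul_sub_mem hw.1 hu ⟨ht0.le, ht1.le⟩
  exact (hf _ ⟨hzU, hwV⟩).not_gt hwf

/-- If three convex open sets form a sunflower with a nonempty kernel, then a point of the third one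
that lies between points of the other two belongs to the kernel. -/
lemma mem_of_sunflower {U₁ U₂ U₃ : Set E} (h₁ : IsOpen U₁) (c₁ : Convex ℝ U₁) (h₂ : IsOpen U₂)
    (c₂ : Convex ℝ U₂) (h₃ : IsOpen U₃) (c₃ : Convex ℝ U₃)
    (h₁₃ : U₁ ∩ U₃ = U₁ ∩ U₂) (h₂₃ : U₂ ∩ U₃ = U₁ ∩ U₂) (hne : (U₁ ∩ U₂).Nonempty)
    {p₁ p₂ p₃ : E} (hp₁ : p₁ ∈ U₁) (hp₂ : p₂ ∈ U₂) (hp₃ : p₃ ∈ U₃) (hp : p₃ ∈ segment ℝ p₁ p₂) :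
    p₃ ∈ U₁ ∩ U₂ := by
  by_contra hp₃W
  obtain ⟨c, hc⟩ := hne
  have hcU₃ : c ∈ U₃ := (h₁₃ ▸ hc : c ∈ U₁ ∩ U₃).2
  set W := U₁ ∩ U₂ with hW
  have hWo : IsOpen W := h₁.inter h₂
  have hWc : Convex ℝ W := c₁.inter c₂
  -- the first point of the segment from `c` to `p₃` outside of the kernel
  let g : ℝ → E := fun t => AffineMap.lineMap c p₃ t
  have hg : Continuous g := AffineMap.lineMap_continuous
  let S : Set ℝ := {t | t ∈ Icc (0 : ℝ) 1 ∧ g t ∉ W}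
  have hS : IsCompact S := isCompact_Icc.inter_right (hWo.isClosed_compl.preimage hg)
  obtain ⟨s, ⟨⟨hs0, hs1⟩, hsW⟩, hmin⟩ := hS.exists_isLeast ⟨1, by simp [S, g, hp₃W]⟩
  have hs : 0 < s := by
    rcases hs0.eq_or_lt with h | h
    · exact absurd (by simpa [g, ← h] using hc) hsW
    · exact h
  have hgU₃ : g s ∈ U₃ := by
    have := c₃.lineMap_mem hcU₃ hp₃ ⟨hs0, hs1⟩
    exact this
  have hcl : g s ∈ closure W := by
    have h1 : s ∈ closure (Ico 0 s) := by
      rw [closure_Ico hs.ne]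
      exact ⟨hs.le, le_rfl⟩
    refine map_mem_closure hg h1 fun t ht => ?_
    by_contra htW
    exact (hmin ⟨⟨ht.1, ht.2.le.trans hs1⟩, htW⟩).not_gt ht.2
  obtain ⟨f, hf⟩ := geometric_hahn_banach_open_point hWc hWo hsW
  -- The exit point `g s` lies in the open set `U₃`, so the functional that separates it from the
  -- kernel bounds both other petals as well.
  have key : ∀ U : Set E, IsOpen U → Convex ℝ U → U ∩ U₃ = W → ∀ u ∈ U, f u < f (g s) := by
    intro U ho hcv hUW u hu
    have hle : ∀ v ∈ U, f v ≤ f (g s) := fun v hv =>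
      le_of_inter_le hcv h₃ hgU₃ (hUW ▸ hcl) (hUW ▸ hf) hv
    -- If the bound were attained at `u`, it would be exceeded slightly beyond `u` on the ray from
    -- `c`, still inside the open set `U`.
    refine (hle u hu).lt_of_ne fun heq => ?_
    have hcont : ContinuousAt (fun t : ℝ => u + t • (u - c)) 0 := by fun_prop
    have hev : ∀ᶠ t : ℝ in nhds 0, u + t • (u - c) ∈ U :=
      hcont.eventually_mem (by simpa using ho.mem_nhds hu)
    obtain ⟨t, htU, ht0⟩ := ((hev.filter_mono nhdsWithin_le_nhds).and
      (self_mem_nhdsWithin : Ioi (0 : ℝ) ∈ nhdsWithin 0 (Ioi 0))).exists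
    have := hle _ htU
    have h2 : f (u + t • (u - c)) = f u + t * (f u - f c) := by simp
    have h3 := mul_pos (show 0 < t from ht0) (sub_pos.2 (heq ▸ hf c hc))
    linarith
  have f₁ := key U₁ h₁ c₁ h₁₃ p₁ hp₁
  have f₂ := key U₂ h₂ c₂ h₂₃ p₂ hp₂
  have hlt : Convex ℝ {x | f x < f (g s)} := convex_halfSpace_lt f.toLinearMap.isLinear _
  have f₃ : f p₃ < f (g s) := hlt.segment_subset f₁ f₂ hp
  -- Both ends of the segment from `c` to `p₃` lie in the open half-space, hence so does `g s`,
  -- which is on its boundary.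
  have : f (g s) < f (g s) := hlt.lineMap_mem (hf c hc) f₃ ⟨hs0, hs1⟩
  exact lt_irrefl _ this

end Sunflower

/-! ### Points, codewords and the non-convexity of `C₀` -/

lemma mem_codeOf {n : ℕ} {E : Type*} {U : Fin n → Set E} {X : Set E} {σ : Finset (Fin n)} :
    σ ∈ codeOf U X ↔ ∃ x ∈ X, ∀ i, i ∈ σ ↔ x ∈ U i := by
  simp only [codeOf, mem_ofPred_eq, Set.Nonempty, mem_sdiff, mem_inter_iff, mem_iInter, mem_iUnion,
    not_exists]
  constructor
  · rintro ⟨x, ⟨hx, h1⟩, h2⟩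
    exact ⟨x, hx, fun i => ⟨h1 i, fun h => by_contra fun hi => h2 i hi h⟩⟩
  · rintro ⟨x, hx, h⟩
    exact ⟨x, ⟨hx, fun i => (h i).1⟩, fun i hi hxi => hi ((h i).2 hxi)⟩

/-- The points of the ambient set obey each rule that the codewords obey. -/
lemma exists_mem_of_codeOf_eq {n : ℕ} {E : Type*} {U : Fin n → Set E} {X : Set E} {C : Code n}
    (h : codeOf U X = C) {x : E} (hx : x ∈ X) : ∃ c ∈ C, ∀ i, i ∈ c ↔ x ∈ U i := by
  classical
  refine ⟨Finset.univ.filter (x ∈ U ·), h ▸ mem_codeOf.2 ⟨x, hx, ?_⟩, ?_⟩ <;> simp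

lemma exists_point_of_codeOf_eq {n : ℕ} {E : Type*} {U : Fin n → Set E} {X : Set E} {C : Code n}
    (h : codeOf U X = C) {c : Finset (Fin n)} (hc : c ∈ C) : ∃ x ∈ X, ∀ i, i ∈ c ↔ x ∈ U i :=
  mem_codeOf.1 (h ▸ hc)

/-- The codewords of `C₀` as a finite set. -/
def codewords : Finset (Finset (Fin 6)) :=
  {{2, 3, 4, 5}, {0, 1, 2}, {0, 3, 4}, {1, 4, 5}, {3, 4}, {4, 5}, {0}, {1}, {2}, ∅}

lemma mem_C₀ {c : Finset (Fin 6)} : c ∈ C₀ ↔ c ∈ codewords := by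
  simp [C₀, codewords]

theorem not_isConvex_C₀ : ¬ IsConvex C₀ := by
  rintro ⟨d, X, U, -, -, hU, hC⟩
  -- A Boolean statement checked on the ten codewords holds at every point of `X`.
  have rule : ∀ p : Finset (Fin 6) → Prop, (∀ c ∈ codewords, p c) → ∀ x ∈ X,
      ∃ c, p c ∧ ∀ i, i ∈ c ↔ x ∈ U i := fun p hp x hx =>
    let ⟨c, hc, h⟩ := exists_mem_of_codeOf_eq hC hx
    ⟨c, hp c (mem_C₀.1 hc), h⟩
  have r₁₃ : U 0 ∩ U 2 = U 0 ∩ U 1 := by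
    ext x
    by_cases hx : x ∈ X
    · obtain ⟨c, hc, h⟩ := rule (fun c => 0 ∈ c ∧ 2 ∈ c ↔ 0 ∈ c ∧ 1 ∈ c) (by decide) x hx
      simpa only [mem_inter_iff, h] using hc
    · exact ⟨fun h => absurd ((hU 0).1 h.1) hx, fun h => absurd ((hU 0).1 h.1) hx⟩
  have r₂₃ : U 1 ∩ U 2 = U 0 ∩ U 1 := by
    ext x
    by_cases hx : x ∈ X
    · obtain ⟨c, hc, h⟩ := rule (fun c => 1 ∈ c ∧ 2 ∈ c ↔ 0 ∈ c ∧ 1 ∈ c) (by decide) x hx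
      simpa only [mem_inter_iff, h] using hc
    · exact ⟨fun h => absurd ((hU 1).1 h.1) hx, fun h => absurd ((hU 1).1 h.2) hx⟩
  obtain ⟨k, -, hk⟩ := exists_point_of_codeOf_eq hC (mem_C₀.2 (by decide : {0, 1, 2} ∈ codewords))
  obtain ⟨x, -, hx⟩ := exists_point_of_codeOf_eq hC (mem_C₀.2 (by decide : {0, 3, 4} ∈ codewords))
  obtain ⟨y, -, hy⟩ := exists_point_of_codeOf_eq hC (mem_C₀.2 (by decide : {1, 4, 5} ∈ codewords))
  have hseg : segment ℝ x y ⊆ U 4 :=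
    (hU 4).2.2.segment_subset ((hx 4).1 (by decide)) ((hy 4).1 (by decide))
  have hcover : segment ℝ x y ⊆ U 3 ∪ U 5 := fun z hz => by
    obtain ⟨c, hc, h⟩ := rule (fun c => 4 ∈ c → 3 ∈ c ∨ 5 ∈ c) (by decide) z
      ((hU 4).1 (hseg hz))
    simp only [h] at hc
    exact hc (hseg hz)
  obtain ⟨z, hz, hz3, hz5⟩ := (convex_segment x y).isPreconnected _ _ (hU 3).2.1 (hU 5).2.1 hcover
    ⟨x, left_mem_segment ℝ x y, (hx 3).1 (by decide)⟩
    ⟨y, right_mem_segment ℝ x y, (hy 5).1 (by decide)⟩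
  -- Only the codeword 3456 contains both 4 and 6.
  obtain ⟨c, hc, h⟩ := rule (fun c => 3 ∈ c ∧ 5 ∈ c → 2 ∈ c ∧ ¬ (0 ∈ c ∧ 1 ∈ c)) (by decide) z
    ((hU 3).1 hz3)
  simp only [h] at hc
  obtain ⟨hz2, hnot⟩ := hc ⟨hz3, hz5⟩
  exact hnot (mem_of_sunflower (hU 0).2.1 (hU 0).2.2 (hU 1).2.1 (hU 1).2.2 (hU 2).2.1 (hU 2).2.2
    r₁₃ r₂₃ ⟨k, (hk 0).1 (by decide), (hk 1).1 (by decide)⟩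
    ((hx 0).1 (by decide)) ((hy 1).1 (by decide)) hz2 hz)

/-! ### Realizations of codes by point maps -/

/-- All trunks of `C` other than the trunk of `i` can be realized by convex open sets at the same
time: `π x` is the codeword at the point `x`. -/
def AlmostRealizable {n : ℕ} (C : Code n) (i : Fin n) : Prop :=
  ∃ (d : ℕ) (π : EuclideanSpace ℝ (Fin d) → C), Function.Surjective π ∧
    ∀ T : Set C, IsTrunk T → T ≠ trunk C {i} → IsOpen (π ⁻¹' T) ∧ Convex ℝ (π ⁻¹' T)

section Morphisms

variable {n m : ℕ} {C : Code n} {D : Code m} {f : C → D}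

lemma mem_trunk {σ : Finset (Fin n)} {c : C} : c ∈ trunk C σ ↔ σ ⊆ c.1 :=
  Iff.rfl

lemma mem_trunk_singleton {i : Fin n} {c : C} : c ∈ trunk C {i} ↔ i ∈ c.1 :=
  Finset.singleton_subset_iff

lemma isTrunk_trunk (σ : Finset (Fin n)) : IsTrunk (trunk C σ) :=
  Or.inr ⟨σ, rfl⟩

/-- The image of `C` under a morphism that forgets the trunk of `i` is convex if all the other
trunks are realizable. -/
theorem AlmostRealizable.isConvex_imageCode {i : Fin n} (hC : AlmostRealizable C i)
    (hf : IsMorphism f) (hi : ∀ j, f ⁻¹' trunk D {j} ≠ trunk C {i}) : IsConvex (imageCode f) := by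
  obtain ⟨d, π, hπ, hT⟩ := hC
  refine ⟨d, univ, fun j => π ⁻¹' (f ⁻¹' trunk D {j}), isOpen_univ, convex_univ,
    fun j => ⟨subset_univ _, hT _ (hf _ (isTrunk_trunk _)) (hi j)⟩, ?_⟩
  ext τ
  rw [mem_codeOf]
  constructor
  · rintro ⟨x, -, hx⟩
    refine ⟨f (π x), ⟨_, rfl⟩, Finset.ext fun j => ?_⟩
    rw [hx j, mem_preimage, mem_preimage, mem_trunk_singleton]
  · rintro ⟨_, ⟨c, rfl⟩, rfl⟩
    obtain ⟨x, rfl⟩ := hπ c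
    exact ⟨x, mem_univ x, fun j => mem_trunk_singleton.symm⟩

/-- A morphism that forgets no trunk of a single neuron is an isomorphism onto its image. -/
theorem isomorphic_imageCode (hf : IsMorphism f)
    (h : ∀ i, ∃ j, f ⁻¹' trunk D {j} = trunk C {i}) : Isomorphic C (imageCode f) := by
  choose φ hφ using h
  have hmem : ∀ (i : Fin n) (c : C), φ i ∈ (f c).1 ↔ i ∈ c.1 := fun i c => by
    rw [← mem_trunk_singleton, ← mem_preimage, hφ, mem_trunk_singleton]
  let F : C → imageCode f := fun c => ⟨(f c).1, f c, ⟨c, rfl⟩, rfl⟩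
  have hF : Function.Bijective F := by
    constructor
    · intro c c' hcc
      have h1 : (f c).1 = (f c').1 := congrArg (fun y : imageCode f => y.1) hcc
      exact Subtype.ext (Finset.ext fun i => by rw [← hmem, ← hmem, h1])
    · rintro ⟨_, _, ⟨c, rfl⟩, rfl⟩
      exact ⟨c, rfl⟩
  let e := Equiv.ofBijective F hF
  refine ⟨e, e.symm, ?_, ?_, e.left_inv, e.right_inv⟩
  · rintro T (rfl | ⟨σ, rfl⟩)
    · exact Or.inl rfl
    · exact hf _ (isTrunk_trunk σ)
  · rintro T (rfl | ⟨σ, rfl⟩)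
    · exact Or.inl rfl
    -- Membership of `i` in `c` is recorded by `φ i` in `f c`, so the inverse pulls the trunk of `σ`
    -- back to that of its image under `φ`.
    · refine Or.inr ⟨σ.image φ, ?_⟩
      ext y
      obtain ⟨c, rfl⟩ := e.surjective y
      rw [mem_preimage, e.symm_apply_apply, mem_trunk, mem_trunk, Finset.image_subset_iff]
      exact forall₂_congr fun i _ => (hmem i c).symm

/-- The trunks that do not contain the trunk of `i` are convex if all trunks other than the trunk
of `i` are realizable. -/
theorem AlmostRealizable.isConvex_trunk {i : Fin n} (hC : AlmostRealizable C i)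
    {σ : Finset (Fin n)} (hσ : ¬ trunk C {i} ⊆ trunk C σ) :
    IsConvex (Subtype.val '' trunk C σ : Code n) := by
  obtain ⟨d, π, hπ, hT⟩ := hC
  -- Inside the trunk of `σ` only trunks of larger sets matter, and none of them is the exceptional
  -- one.
  have hne : ∀ τ, σ ⊆ τ → trunk C τ ≠ trunk C {i} := fun τ hτ h =>
    hσ (h ▸ fun c hc => hτ.trans hc)
  obtain ⟨ho, hc⟩ := hT _ (isTrunk_trunk σ) (hne σ subset_rfl)
  refine ⟨d, π ⁻¹' trunk C σ, fun j => π ⁻¹' trunk C (insert j σ), ho, hc,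
    fun j => ⟨fun x hx => (Finset.subset_insert j σ).trans hx,
      hT _ (isTrunk_trunk _) (hne _ (Finset.subset_insert j σ))⟩, ?_⟩
  ext τ
  rw [mem_codeOf]
  have key : ∀ x ∈ π ⁻¹' trunk C σ, ∀ j, x ∈ π ⁻¹' trunk C (insert j σ) ↔ j ∈ (π x).1 := by
    intro x hx j
    rw [mem_preimage, mem_trunk, Finset.insert_subset_iff]
    exact and_iff_left hx
  constructor
  · rintro ⟨x, hx, h⟩
    exact ⟨π x, hx, Finset.ext fun j => by rw [h, key x hx]⟩
  · rintro ⟨c, hc, rfl⟩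
    obtain ⟨x, rfl⟩ := hπ c
    exact ⟨x, hc, fun j => (key x hc j).symm⟩

end Morphisms

lemma isConvex_empty {n : ℕ} : IsConvex (∅ : Code n) := by
  refine ⟨0, ∅, fun _ => ∅, isOpen_empty, convex_empty,
    fun _ => ⟨subset_rfl, isOpen_empty, convex_empty⟩, ?_⟩
  ext σ
  simp [mem_codeOf]

/-! ### Realizations of `C₀` up to one neuron -/

/-- The set is convex and open. -/
def OpenConvex {E : Type*} [TopologicalSpace E] [AddCommMonoid E] [Module ℝ E] (s : Set E) : Prop :=
  IsOpen s ∧ Convex ℝ s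

/-- Sets that realize a code and are convex and open up to `U i` realize all trunks other than the
trunk of `i`, if `U i` meets the other sets properly in convex open sets. -/
theorem almostRealizable_of_codeOf {n d : ℕ} {C : Code n} {i : Fin n}
    (U : Fin n → Set (EuclideanSpace ℝ (Fin d))) (hC : codeOf U univ = C)
    (h : ∀ k ≠ i, OpenConvex (U k)) (hi : ∀ k, U i ⊆ U k ∨ OpenConvex (U i ∩ U k)) :
    AlmostRealizable C i := by
  classical
  choose p hpC hp using fun x => exists_mem_of_codeOf_eq hC (mem_univ x)
  let π : EuclideanSpace ℝ (Fin d) → C := fun x => ⟨p x, hpC x⟩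
  have hπ : Function.Surjective π := by
    rintro ⟨c, hc⟩
    obtain ⟨x, -, hx⟩ := exists_point_of_codeOf_eq hC hc
    exact ⟨x, Subtype.ext (Finset.ext fun k => by rw [hx]; exact hp x k)⟩
  have hpre : ∀ σ, π ⁻¹' trunk C σ = ⋂ k ∈ σ, U k := fun σ => by
    ext x
    simp only [mem_preimage, mem_trunk, mem_iInter, ← hp, π]
    rfl
  refine ⟨d, π, hπ, ?_⟩
  rintro T (rfl | ⟨σ, rfl⟩) hT
  · exact ⟨isOpen_empty, convex_empty⟩
  have hInter : ∀ V : Fin n → Set (EuclideanSpace ℝ (Fin d)), (∀ k ∈ σ, OpenConvex (V k)) →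
      OpenConvex (⋂ k ∈ σ, V k) := fun V hV =>
    ⟨isOpen_biInter_finset fun k hk => (hV k hk).1, convex_iInter₂ fun k hk => (hV k hk).2⟩
  by_cases hσ : i ∈ σ
  -- If `U i` lay in every `U k` with `k ∈ σ`, the trunk of `σ` would be the excluded trunk of `i`.
  · have hex : ∃ k ∈ σ, ¬ U i ⊆ U k := by
      by_contra! hall
      refine hT (preimage_injective.2 hπ ?_)
      rw [hpre, hpre]
      refine Subset.antisymm (fun x hx => ?_) fun x hx => ?_
      · simpa using mem_iInter₂.1 hx i hσ
      · exact mem_iInter₂.2 fun k hk => hall k hk (by simpa using hx)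
    obtain ⟨k₀, hk₀, hnot⟩ := hex
    -- Factors that contain `U i` are redundant; the factor at `k₀` retains `U i`, so only open
    -- convex intersections remain.
    have : π ⁻¹' trunk C σ = ⋂ k ∈ σ, if U i ⊆ U k then univ else U i ∩ U k := by
      rw [hpre]
      refine Subset.antisymm (fun x hx => ?_) fun x hx => ?_ <;> rw [mem_iInter₂] at hx ⊢
      · intro k hk
        split_ifs
        · trivial
        · exact ⟨hx i hσ, hx k hk⟩
      · intro k hk
        have h0 := hx k₀ hk₀
        have h1 := hx k hk
        rw [if_neg hnot] at h0
        split_ifs at h1 with h2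
        · exact h2 h0.1
        · exact h1.2
    rw [this]
    refine hInter _ fun k _ => ?_
    split_ifs with h2
    · exact ⟨isOpen_univ, convex_univ⟩
    · exact (hi k).resolve_left h2
  · rw [hpre]
    exact hInter U fun k hk => h k fun hki => hσ (hki ▸ hk)

/-- The rules that define the code `C₀`. -/
lemma codeOf_eq_C₀ {E : Type*} {U : Fin 6 → Set E}
    (h₁ : ∀ x, x ∈ U 4 ↔ x ∈ U 3 ∨ x ∈ U 5)
    (h₂ : ∀ x, x ∈ U 3 ∧ x ∈ U 5 ↔ x ∈ U 2 ∧ x ∈ U 4)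
    (h₃ : ∀ x, x ∈ U 0 ∧ x ∈ U 1 ↔ x ∈ U 0 ∧ x ∈ U 2)
    (h₄ : ∀ x, x ∈ U 0 ∧ x ∈ U 1 ↔ x ∈ U 1 ∧ x ∈ U 2)
    (h₅ : ∀ x, x ∈ U 0 ∧ x ∈ U 4 → x ∈ U 3)
    (h₆ : ∀ x, x ∈ U 1 ∧ x ∈ U 4 → x ∈ U 5)
    (h₇ : ∀ x, ¬ (x ∈ U 0 ∧ x ∈ U 1 ∧ x ∈ U 4))
    (hp : ∀ c ∈ codewords, ∃ x, ∀ i, i ∈ c ↔ x ∈ U i) : codeOf U univ = C₀ := by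
  -- A finite check over the 64 subsets of the six neurons.
  have rules : ∀ c : Finset (Fin 6), ((4 ∈ c ↔ 3 ∈ c ∨ 5 ∈ c) ∧
      (3 ∈ c ∧ 5 ∈ c ↔ 2 ∈ c ∧ 4 ∈ c) ∧ (0 ∈ c ∧ 1 ∈ c ↔ 0 ∈ c ∧ 2 ∈ c) ∧
      (0 ∈ c ∧ 1 ∈ c ↔ 1 ∈ c ∧ 2 ∈ c) ∧ (0 ∈ c ∧ 4 ∈ c → 3 ∈ c) ∧ (1 ∈ c ∧ 4 ∈ c → 5 ∈ c) ∧
      ¬ (0 ∈ c ∧ 1 ∈ c ∧ 4 ∈ c)) → c ∈ codewords := by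
    decide
  ext c
  rw [mem_codeOf, mem_C₀]
  constructor
  · rintro ⟨x, -, hx⟩
    apply rules
    simp only [hx]
    exact ⟨h₁ x, h₂ x, h₃ x, h₄ x, h₅ x, h₆ x, h₇ x⟩
  · intro hc
    obtain ⟨x, hx⟩ := hp c hc
    exact ⟨x, mem_univ x, hx⟩

section HalfSpaces

variable {E : Type*} [TopologicalSpace E] [AddCommMonoid E] [Module ℝ E]

lemma OpenConvex.and {p q : E → Prop} (hp : OpenConvex {x | p x}) (hq : OpenConvex {x | q x}) :
    OpenConvex {x | p x ∧ q x} :=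
  ⟨hp.1.inter hq.1, hp.2.inter hq.2⟩

lemma OpenConvex.congr {s t : Set E} (hs : OpenConvex s) (h : ∀ x, x ∈ t ↔ x ∈ s) :
    OpenConvex t :=
  Set.ext h ▸ hs

lemma openConvex_empty : OpenConvex (∅ : Set E) :=
  ⟨isOpen_empty, convex_empty⟩

variable {d : ℕ}

lemma openConvex_lt (k : Fin d) (a : ℝ) :
    OpenConvex {x : EuclideanSpace ℝ (Fin d) | x k < a} :=
  ⟨isOpen_lt (by fun_prop) continuous_const, convex_halfSpace_lt ⟨by simp, by simp⟩ a⟩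

lemma openConvex_gt (k : Fin d) (a : ℝ) :
    OpenConvex {x : EuclideanSpace ℝ (Fin d) | a < x k} :=
  ⟨isOpen_lt continuous_const (by fun_prop), convex_halfSpace_gt ⟨by simp, by simp⟩ a⟩

lemma openConvex_sum_gt (w : Fin d → ℝ) (a : ℝ) :
    OpenConvex {x : EuclideanSpace ℝ (Fin d) | a < ∑ k, w k * x k} := by
  refine ⟨isOpen_lt continuous_const (by fun_prop), convex_halfSpace_gt ⟨fun x y => ?_,
    fun c x => ?_⟩ a⟩
  · simp [mul_add, Finset.sum_add_distrib]
  · simp [Finset.mul_sum, mul_left_comm]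

lemma openConvex_add_gt (a : ℝ) :
    OpenConvex {x : EuclideanSpace ℝ (Fin 2) | a < x 0 + x 1} := by
  simpa [Fin.sum_univ_two] using openConvex_sum_gt (fun _ : Fin 2 => 1) a

lemma openConvex_sub_gt (a : ℝ) :
    OpenConvex {x : EuclideanSpace ℝ (Fin 2) | a < -x 0 + x 1} := by
  simpa [Fin.sum_univ_two] using openConvex_sum_gt ![-1, 1] a

lemma openConvex_add_add_gt (a : ℝ) :
    OpenConvex {x : EuclideanSpace ℝ (Fin 3) | a < x 0 + x 1 + x 2} := by
  simpa [Fin.sum_univ_three] using openConvex_sum_gt (fun _ : Fin 3 => 1) a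

end HalfSpaces

lemma forall_fin_six {p : Fin 6 → Prop} : (∀ i, p i) ↔ p 0 ∧ p 1 ∧ p 2 ∧ p 3 ∧ p 4 ∧ p 5 := by
  refine ⟨fun h => ⟨h 0, h 1, h 2, h 3, h 4, h 5⟩, fun ⟨h0, h1, h2, h3, h4, h5⟩ i => ?_⟩
  fin_cases i <;> assumption

/-- A realization of `C₀` by sets in dimension 2 that are open and convex, except for the set of
the neuron 1. -/
def setsZero : Fin 6 → Set (EuclideanSpace ℝ (Fin 2)) :=
  ![{x | (3 < x 0 + x 1 ∧ -1 < x 0 ∧ x 0 < 1) ∨ (x 0 < -2 ∧ 0 < x 1 ∧ x 1 < 3)},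
    {x | 3 < x 0 + x 1},
    {x | -1 < x 0 ∧ x 0 < 1 ∧ 0 < x 1},
    {x | x 0 < 1 ∧ 0 < x 1 ∧ x 1 < 1},
    {x | 0 < x 1 ∧ x 1 < 1},
    {x | -1 < x 0 ∧ 0 < x 1 ∧ x 1 < 1}]

/-- The set of 5 is a horizontal strip, covered by a left part (4) and a right part (6) that overlap
in a square. The set of 3 is the upward column over that square. The set of 1 breaks into the
kernel, high in the column, and a piece that crosses the strip on the far left. -/
lemma codeOf_setsZero : codeOf setsZero univ = C₀ := by
  apply codeOf_eq_C₀ <;>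
    simp only [setsZero, Fin.isValue, Matrix.cons_val, mem_ofPred_eq]
  -- The eighth goal asks for one point per codeword; the points follow the order of `codewords`.
  on_goal 8 =>
    simp only [codewords, Finset.forall_mem_insert, Finset.mem_singleton, forall_eq,
      forall_fin_six]
    refine ⟨⟨!₂[0, 1 / 2], ?_⟩, ⟨!₂[0, 4], ?_⟩, ⟨!₂[-3, 1 / 2], ?_⟩, ⟨!₂[3, 1 / 2], ?_⟩,
      ⟨!₂[-3 / 2, 1 / 2], ?_⟩, ⟨!₂[3 / 2, 1 / 2], ?_⟩, ⟨!₂[-3, 2], ?_⟩, ⟨!₂[3, 2], ?_⟩,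
      ⟨!₂[0, 2], ?_⟩, ⟨!₂[0, -1], ?_⟩⟩ <;>
      simp <;> norm_num
  all_goals grind

theorem almostRealizable_zero : AlmostRealizable C₀ 0 := by
  refine almostRealizable_of_codeOf setsZero codeOf_setsZero ?_ ?_ <;>
    simp only [forall_fin_six, setsZero, Fin.isValue, Matrix.cons_val]
  · refine ⟨fun h => absurd rfl h, fun _ => ?_, fun _ => ?_,
      fun _ => ?_, fun _ => ?_, fun _ => ?_⟩ <;>
      apply_rules [OpenConvex.and, openConvex_lt, openConvex_gt, openConvex_add_gt,
        openConvex_sub_gt]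
  · refine ⟨.inl subset_rfl,
      .inr (.congr (s := {x | 3 < x 0 + x 1 ∧ -1 < x 0 ∧ x 0 < 1}) ?_ ?_),
      .inr (.congr (s := {x | 3 < x 0 + x 1 ∧ -1 < x 0 ∧ x 0 < 1}) ?_ ?_),
      .inr (.congr (s := {x | x 0 < -2 ∧ 0 < x 1 ∧ x 1 < 1}) ?_ ?_),
      .inr (.congr (s := {x | x 0 < -2 ∧ 0 < x 1 ∧ x 1 < 1}) ?_ ?_),
      .inr (.congr openConvex_empty ?_)⟩
    all_goals try simp only [mem_inter_iff, mem_ofPred_eq, mem_empty_iff_false]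
    all_goals first
      | grind
      | apply_rules [OpenConvex.and, openConvex_lt, openConvex_gt, openConvex_add_gt,
        openConvex_sub_gt]

/-- A realization of `C₀` by sets in dimension 2 that are open and convex, except for the set of
the neuron 2. -/
def setsOne : Fin 6 → Set (EuclideanSpace ℝ (Fin 2)) :=
  ![{x | 3 < -x 0 + x 1},
    {x | (3 < -x 0 + x 1 ∧ -1 < x 0 ∧ x 0 < 1) ∨ (2 < x 0 ∧ 0 < x 1 ∧ x 1 < 3)},
    {x | -1 < x 0 ∧ x 0 < 1 ∧ 0 < x 1},
    {x | x 0 < 1 ∧ 0 < x 1 ∧ x 1 < 1},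
    {x | 0 < x 1 ∧ x 1 < 1},
    {x | -1 < x 0 ∧ 0 < x 1 ∧ x 1 < 1}]

/-- The mirror image of `setsZero` under `x 0 ↦ -x 0`, which exchanges neurons 1 with 2 and 4 with
6. -/
lemma codeOf_setsOne : codeOf setsOne univ = C₀ := by
  apply codeOf_eq_C₀ <;>
    simp only [setsOne, Fin.isValue, Matrix.cons_val, mem_ofPred_eq]
  on_goal 8 =>
    simp only [codewords, Finset.forall_mem_insert, Finset.mem_singleton, forall_eq,
      forall_fin_six]
    refine ⟨⟨!₂[0, 1 / 2], ?_⟩, ⟨!₂[0, 4], ?_⟩, ⟨!₂[-3, 1 / 2], ?_⟩, ⟨!₂[3, 1 / 2], ?_⟩,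
      ⟨!₂[-3 / 2, 1 / 2], ?_⟩, ⟨!₂[3 / 2, 1 / 2], ?_⟩, ⟨!₂[-3, 2], ?_⟩, ⟨!₂[3, 2], ?_⟩,
      ⟨!₂[0, 2], ?_⟩, ⟨!₂[0, -1], ?_⟩⟩ <;>
      simp <;> norm_num
  all_goals grind

theorem almostRealizable_one : AlmostRealizable C₀ 1 := by
  refine almostRealizable_of_codeOf setsOne codeOf_setsOne ?_ ?_ <;>
    simp only [forall_fin_six, setsOne, Fin.isValue, Matrix.cons_val]
  · refine ⟨fun _ => ?_, fun h => absurd rfl h, fun _ => ?_,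
      fun _ => ?_, fun _ => ?_, fun _ => ?_⟩ <;>
      apply_rules [OpenConvex.and, openConvex_lt, openConvex_gt, openConvex_add_gt,
        openConvex_sub_gt]
  · refine ⟨.inr (.congr (s := {x | 3 < -x 0 + x 1 ∧ -1 < x 0 ∧ x 0 < 1}) ?_ ?_),
      .inl subset_rfl,
      .inr (.congr (s := {x | 3 < -x 0 + x 1 ∧ -1 < x 0 ∧ x 0 < 1}) ?_ ?_),
      .inr (.congr openConvex_empty ?_),
      .inr (.congr (s := {x | 2 < x 0 ∧ 0 < x 1 ∧ x 1 < 1}) ?_ ?_),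
      .inr (.congr (s := {x | 2 < x 0 ∧ 0 < x 1 ∧ x 1 < 1}) ?_ ?_)⟩
    all_goals try simp only [mem_inter_iff, mem_ofPred_eq, mem_empty_iff_false]
    all_goals first
      | grind
      | apply_rules [OpenConvex.and, openConvex_lt, openConvex_gt, openConvex_add_gt,
        openConvex_sub_gt]

/-- A realization of `C₀` by sets in dimension 2 that are open and convex, except for the set of
the neuron 3. -/
def setsTwo : Fin 6 → Set (EuclideanSpace ℝ (Fin 2)) :=
  ![{x | 3 < -x 0 + x 1},
    {x | 3 < x 0 + x 1},
    {x | (3 < -x 0 + x 1 ∧ 3 < x 0 + x 1) ∨ (-1 < x 0 ∧ x 0 < 1 ∧ -1 < x 1 ∧ x 1 < 1)},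
    {x | x 0 < 1 ∧ 0 < x 1 ∧ x 1 < 1},
    {x | 0 < x 1 ∧ x 1 < 1},
    {x | -1 < x 0 ∧ 0 < x 1 ∧ x 1 < 1}]

/-- The sets of 1 and 2 are half-planes that meet above the strip. The set of 3 breaks into their
intersection and a square through the strip, prolonged below it to make room for the codeword 3. -/
lemma codeOf_setsTwo : codeOf setsTwo univ = C₀ := by
  apply codeOf_eq_C₀ <;>
    simp only [setsTwo, Fin.isValue, Matrix.cons_val, mem_ofPred_eq]
  on_goal 8 =>
    simp only [codewords, Finset.forall_mem_insert, Finset.mem_singleton, forall_eq,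
      forall_fin_six]
    refine ⟨⟨!₂[0, 1 / 2], ?_⟩, ⟨!₂[0, 4], ?_⟩, ⟨!₂[-3, 1 / 2], ?_⟩, ⟨!₂[3, 1 / 2], ?_⟩,
      ⟨!₂[-3 / 2, 1 / 2], ?_⟩, ⟨!₂[3 / 2, 1 / 2], ?_⟩, ⟨!₂[-3, 2], ?_⟩, ⟨!₂[3, 2], ?_⟩,
      ⟨!₂[0, -1 / 2], ?_⟩, ⟨!₂[0, -2], ?_⟩⟩ <;>
      simp <;> norm_num
  all_goals grind

theorem almostRealizable_two : AlmostRealizable C₀ 2 := by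
  refine almostRealizable_of_codeOf setsTwo codeOf_setsTwo ?_ ?_ <;>
    simp only [forall_fin_six, setsTwo, Fin.isValue, Matrix.cons_val]
  · refine ⟨fun _ => ?_, fun _ => ?_, fun h => absurd rfl h,
      fun _ => ?_, fun _ => ?_, fun _ => ?_⟩ <;>
      apply_rules [OpenConvex.and, openConvex_lt, openConvex_gt, openConvex_add_gt,
        openConvex_sub_gt]
  · refine ⟨.inr (.congr (s := {x | 3 < -x 0 + x 1 ∧ 3 < x 0 + x 1}) ?_ ?_),
      .inr (.congr (s := {x | 3 < -x 0 + x 1 ∧ 3 < x 0 + x 1}) ?_ ?_),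
      .inl subset_rfl,
      .inr (.congr (s := {x | -1 < x 0 ∧ x 0 < 1 ∧ 0 < x 1 ∧ x 1 < 1}) ?_ ?_),
      .inr (.congr (s := {x | -1 < x 0 ∧ x 0 < 1 ∧ 0 < x 1 ∧ x 1 < 1}) ?_ ?_),
      .inr (.congr (s := {x | -1 < x 0 ∧ x 0 < 1 ∧ 0 < x 1 ∧ x 1 < 1}) ?_ ?_)⟩
    all_goals try simp only [mem_inter_iff, mem_ofPred_eq]
    all_goals first
      | grind
      | apply_rules [OpenConvex.and, openConvex_lt, openConvex_gt, openConvex_add_gt,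
        openConvex_sub_gt]

/-- A realization of `C₀` by sets in dimension 3 that are open and convex, except for the set of
the neuron 4. -/
def setsThree : Fin 6 → Set (EuclideanSpace ℝ (Fin 3)) :=
  ![{x | -1 < x 1 ∧ x 1 < 1 ∧ -1 < x 2 ∧ x 2 < 1},
    {x | -1 < x 0 ∧ x 0 < 1 ∧ -1 < x 2 ∧ x 2 < 1},
    {x | -1 < x 0 ∧ x 0 < 1 ∧ -1 < x 1 ∧ x 1 < 1},
    {x | 3 < x 0 + x 1 + x 2 ∧ (1 ≤ x 0 ∨ (-1 < x 0 ∧ -1 < x 1 ∧ x 1 < 1))},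
    {x | 3 < x 0 + x 1 + x 2},
    {x | 3 < x 0 + x 1 + x 2 ∧ x 0 < 1}]

/-- The sets of 1, 2, 3 are square beams along the three axes that meet in a cube. The half-space of
5 misses the cube but cuts all beams. The set of 6 is its part with `x 0 < 1`; the set of 4 is the
remaining part together with the end of the third beam. -/
lemma codeOf_setsThree : codeOf setsThree univ = C₀ := by
  apply codeOf_eq_C₀ <;>
    simp only [setsThree, Fin.isValue, Matrix.cons_val, mem_ofPred_eq]
  on_goal 8 =>
    simp only [codewords, Finset.forall_mem_insert, Finset.mem_singleton, forall_eq,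
      forall_fin_six]
    refine ⟨⟨!₂[0, 0, 4], ?_⟩, ⟨!₂[0, 0, 0], ?_⟩, ⟨!₂[4, 0, 0], ?_⟩, ⟨!₂[0, 4, 0], ?_⟩,
      ⟨!₂[5, 0, 5], ?_⟩, ⟨!₂[0, 5, 5], ?_⟩, ⟨!₂[2, 0, 0], ?_⟩, ⟨!₂[0, 2, 0], ?_⟩,
      ⟨!₂[0, 0, 2], ?_⟩, ⟨!₂[-5, -5, -5], ?_⟩⟩ <;>
      simp <;> norm_num
  all_goals grind

theorem almostRealizable_three : AlmostRealizable C₀ 3 := by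
  refine almostRealizable_of_codeOf setsThree codeOf_setsThree ?_ ?_ <;>
    simp only [forall_fin_six, setsThree, Fin.isValue, Matrix.cons_val]
  · refine ⟨fun _ => ?_, fun _ => ?_, fun _ => ?_,
      fun h => absurd rfl h, fun _ => ?_, fun _ => ?_⟩ <;>
      apply_rules [OpenConvex.and, openConvex_lt, openConvex_gt, openConvex_add_add_gt]
  -- The closed condition `1 ≤ x 0` disappears in these intersections: the first beam has `x 0 > 1`
  -- in the half-space, and the second and third beams and the set of 6 have `x 0 < 1`.
  · refine ⟨.inr (.congr (s := {x | 3 < x 0 + x 1 + x 2 ∧ -1 < x 1 ∧ x 1 < 1 ∧ -1 < x 2 ∧ x 2 < 1}) ?_ ?_),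
      .inr (.congr openConvex_empty ?_),
      .inr (.congr (s := {x | 3 < x 0 + x 1 + x 2 ∧ -1 < x 0 ∧ x 0 < 1 ∧ -1 < x 1 ∧ x 1 < 1}) ?_ ?_),
      .inl subset_rfl,
      .inl fun x hx => hx.1,
      .inr (.congr (s := {x | 3 < x 0 + x 1 + x 2 ∧ -1 < x 0 ∧ x 0 < 1 ∧ -1 < x 1 ∧ x 1 < 1}) ?_ ?_)⟩
    all_goals try simp only [mem_inter_iff, mem_ofPred_eq, mem_empty_iff_false]
    all_goals first
      | grind
      | apply_rules [OpenConvex.and, openConvex_lt, openConvex_gt, openConvex_add_add_gt]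

/-- A realization of `C₀` by sets in dimension 3 that are open and convex, except for the set of
the neuron 5. -/
def setsFour : Fin 6 → Set (EuclideanSpace ℝ (Fin 3)) :=
  ![{x | -1 < x 1 ∧ x 1 < 1 ∧ -1 < x 2 ∧ x 2 < 1},
    {x | -1 < x 0 ∧ x 0 < 1 ∧ -1 < x 2 ∧ x 2 < 1},
    {x | -1 < x 0 ∧ x 0 < 1 ∧ -1 < x 1 ∧ x 1 < 1},
    {x | 3 < x 0 + x 1 + x 2 ∧ -1 < x 1 ∧ x 1 < 1},
    {x | 3 < x 0 + x 1 + x 2 ∧ ((-1 < x 1 ∧ x 1 < 1) ∨ (-1 < x 0 ∧ x 0 < 1))},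
    {x | 3 < x 0 + x 1 + x 2 ∧ -1 < x 0 ∧ x 0 < 1}]

/-- With the same beams, the sets of 4 and 6 are two slabs of the half-space that cross in the end
of the third beam. The set of 5 is their union, the only set that is not convex. -/
lemma codeOf_setsFour : codeOf setsFour univ = C₀ := by
  apply codeOf_eq_C₀ <;>
    simp only [setsFour, Fin.isValue, Matrix.cons_val, mem_ofPred_eq]
  on_goal 8 =>
    simp only [codewords, Finset.forall_mem_insert, Finset.mem_singleton, forall_eq,
      forall_fin_six]
    refine ⟨⟨!₂[0, 0, 4], ?_⟩, ⟨!₂[0, 0, 0], ?_⟩, ⟨!₂[4, 0, 0], ?_⟩, ⟨!₂[0, 4, 0], ?_⟩,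
      ⟨!₂[5, 0, 5], ?_⟩, ⟨!₂[0, 5, 5], ?_⟩, ⟨!₂[2, 0, 0], ?_⟩, ⟨!₂[0, 2, 0], ?_⟩,
      ⟨!₂[0, 0, 2], ?_⟩, ⟨!₂[-5, -5, -5], ?_⟩⟩ <;>
      simp <;> norm_num
  all_goals grind

theorem almostRealizable_four : AlmostRealizable C₀ 4 := by
  refine almostRealizable_of_codeOf setsFour codeOf_setsFour ?_ ?_ <;>
    simp only [forall_fin_six, setsFour, Fin.isValue, Matrix.cons_val]
  · refine ⟨fun _ => ?_, fun _ => ?_, fun _ => ?_,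
      fun _ => ?_, fun h => absurd rfl h, fun _ => ?_⟩ <;>
      apply_rules [OpenConvex.and, openConvex_lt, openConvex_gt, openConvex_add_add_gt]
  · refine ⟨.inr (.congr (s := {x | 3 < x 0 + x 1 + x 2 ∧ -1 < x 1 ∧ x 1 < 1 ∧ -1 < x 2 ∧ x 2 < 1}) ?_ ?_),
      .inr (.congr (s := {x | 3 < x 0 + x 1 + x 2 ∧ -1 < x 0 ∧ x 0 < 1 ∧ -1 < x 2 ∧ x 2 < 1}) ?_ ?_),
      .inr (.congr (s := {x | 3 < x 0 + x 1 + x 2 ∧ -1 < x 0 ∧ x 0 < 1 ∧ -1 < x 1 ∧ x 1 < 1}) ?_ ?_),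
      .inr (.congr (s := {x | 3 < x 0 + x 1 + x 2 ∧ -1 < x 1 ∧ x 1 < 1}) ?_ ?_),
      .inl subset_rfl,
      .inr (.congr (s := {x | 3 < x 0 + x 1 + x 2 ∧ -1 < x 0 ∧ x 0 < 1}) ?_ ?_)⟩
    all_goals try simp only [mem_inter_iff, mem_ofPred_eq]
    all_goals first
      | grind
      | apply_rules [OpenConvex.and, openConvex_lt, openConvex_gt, openConvex_add_add_gt]

/-- A realization of `C₀` by sets in dimension 3 that are open and convex, except for the set of
the neuron 6. -/
def setsFive : Fin 6 → Set (EuclideanSpace ℝ (Fin 3)) :=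
  ![{x | -1 < x 1 ∧ x 1 < 1 ∧ -1 < x 2 ∧ x 2 < 1},
    {x | -1 < x 0 ∧ x 0 < 1 ∧ -1 < x 2 ∧ x 2 < 1},
    {x | -1 < x 0 ∧ x 0 < 1 ∧ -1 < x 1 ∧ x 1 < 1},
    {x | 3 < x 0 + x 1 + x 2 ∧ x 1 < 1},
    {x | 3 < x 0 + x 1 + x 2},
    {x | 3 < x 0 + x 1 + x 2 ∧ (1 ≤ x 1 ∨ (-1 < x 1 ∧ -1 < x 0 ∧ x 0 < 1))}]

/-- This is `setsThree` with the first two coordinates exchanged, along with neurons 1 and 2 and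
neurons 4 and 6. -/
lemma codeOf_setsFive : codeOf setsFive univ = C₀ := by
  apply codeOf_eq_C₀ <;>
    simp only [setsFive, Fin.isValue, Matrix.cons_val, mem_ofPred_eq]
  on_goal 8 =>
    simp only [codewords, Finset.forall_mem_insert, Finset.mem_singleton, forall_eq,
      forall_fin_six]
    refine ⟨⟨!₂[0, 0, 4], ?_⟩, ⟨!₂[0, 0, 0], ?_⟩, ⟨!₂[4, 0, 0], ?_⟩, ⟨!₂[0, 4, 0], ?_⟩,
      ⟨!₂[5, 0, 5], ?_⟩, ⟨!₂[0, 5, 5], ?_⟩, ⟨!₂[2, 0, 0], ?_⟩, ⟨!₂[0, 2, 0], ?_⟩,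
      ⟨!₂[0, 0, 2], ?_⟩, ⟨!₂[-5, -5, -5], ?_⟩⟩ <;>
      simp <;> norm_num
  all_goals grind

theorem almostRealizable_five : AlmostRealizable C₀ 5 := by
  refine almostRealizable_of_codeOf setsFive codeOf_setsFive ?_ ?_ <;>
    simp only [forall_fin_six, setsFive, Fin.isValue, Matrix.cons_val]
  · refine ⟨fun _ => ?_, fun _ => ?_, fun _ => ?_,
      fun _ => ?_, fun _ => ?_, fun h => absurd rfl h⟩ <;>
      apply_rules [OpenConvex.and, openConvex_lt, openConvex_gt, openConvex_add_add_gt]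
  · refine ⟨.inr (.congr openConvex_empty ?_),
      .inr (.congr (s := {x | 3 < x 0 + x 1 + x 2 ∧ -1 < x 0 ∧ x 0 < 1 ∧ -1 < x 2 ∧ x 2 < 1}) ?_ ?_),
      .inr (.congr (s := {x | 3 < x 0 + x 1 + x 2 ∧ -1 < x 0 ∧ x 0 < 1 ∧ -1 < x 1 ∧ x 1 < 1}) ?_ ?_),
      .inr (.congr (s := {x | 3 < x 0 + x 1 + x 2 ∧ -1 < x 0 ∧ x 0 < 1 ∧ -1 < x 1 ∧ x 1 < 1}) ?_ ?_),
      .inl fun x hx => hx.1,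
      .inl subset_rfl⟩
    all_goals try simp only [mem_inter_iff, mem_ofPred_eq, mem_empty_iff_false]
    all_goals first
      | grind
      | apply_rules [OpenConvex.and, openConvex_lt, openConvex_gt, openConvex_add_add_gt]

/-! ### Cones and vertex maps -/

section Complexes

variable {n : ℕ} {K : LowerSet (Finset (Fin n))}

lemma eq_Iic_of_forall_subset {v : Fin n} (hv : {v} ∈ K) (h : ∀ τ ∈ K, τ ⊆ {v}) :
    K = LowerSet.Iic {v} :=
  SetLike.ext fun τ => ⟨fun hτ => h τ hτ, fun hτ => K.lower hτ hv⟩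

/-- Removing the faces that contain a given face. -/
def deleteFace (K : LowerSet (Finset (Fin n))) (ρ : Finset (Fin n)) :
    LowerSet (Finset (Fin n)) where
  carrier := {γ | γ ∈ K ∧ ¬ ρ ⊆ γ}
  lower' := fun _ _ hba ha => ⟨K.lower hba ha.1, fun h => ha.2 (h.trans hba)⟩

/-- A cone is collapsible. -/
theorem isCollapsible_of_cone {v : Fin n} (hK : ∅ ∈ K) (hv : ∀ τ ∈ K, insert v τ ∈ K) :
    IsCollapsible K := by
  refine ⟨v, ?_⟩
  induction hN : (K : Set (Finset (Fin n))).ncard using Nat.strong_induction_on generalizing K with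
  | _ N ih =>
    have hvK : {v} ∈ K := hv ∅ hK
    by_cases h : ∀ τ ∈ K, τ ⊆ {v}
    · rw [eq_Iic_of_forall_subset hvK h]
    push Not at h
    obtain ⟨α, hα, hαv⟩ := h
    -- A facet `τ` other than the apex contains `v`, and `τ.erase v` is a free face of it: a face
    -- containing `τ.erase v` still lies in `τ` after `v` is added. Deleting this pair leaves a
    -- smaller cone.
    obtain ⟨τ, hατ, hτ⟩ := (Set.toFinite (K : Set (Finset (Fin n)))).exists_le_maximal hα
    have hvτ : v ∈ τ := hτ.2 (hv τ hτ.1) (Finset.subset_insert v τ) (Finset.mem_insert_self v τ)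
    have hne : (τ.erase v).Nonempty := by
      rw [Finset.nonempty_iff_ne_empty, Ne, Finset.erase_eq_empty_iff]
      rintro (h | h)
      · simp [h] at hvτ
      · exact hαv (hατ.trans h.subset)
    have hKL : Collapses K (deleteFace K (τ.erase v)) := by
      refine ⟨τ.erase v, τ, hne, Finset.erase_ssubset hvτ, hτ.1, fun γ hγ hsub => ?_, rfl⟩
      have h1 : τ ⊆ insert v γ := by
        rw [← Finset.insert_erase hvτ]
        exact Finset.insert_subset_insert v hsub
      exact (Finset.subset_insert v γ).trans (hτ.2 (hv γ hγ) h1)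
    refine Relation.ReflTransGen.head hKL (ih _ ?_ ?_ ?_ rfl)
    · rw [← hN]
      refine Set.ncard_lt_ncard ⟨fun γ hγ => hγ.1, fun h => ?_⟩ (Set.toFinite _)
      exact (h hτ.1).2 (Finset.erase_subset v τ)
    · exact ⟨hK, fun h => hne.ne_empty (Finset.subset_empty.1 h)⟩
    · refine fun γ hγ => ⟨hv γ hγ.1, fun h => hγ.2 fun i hi => ?_⟩
      exact Finset.mem_of_mem_insert_of_ne (h hi) (Finset.ne_of_mem_erase hi)

/-- Two self-maps of a complex that send each point to two points of a common face are homotopic. -/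
lemma homotopic_of_common_face (f g : C(realization K, realization K))
    (h : ∀ x, ∃ τ ∈ K, ∀ i ∉ τ, (f x).1 i = 0 ∧ (g x).1 i = 0) : f.Homotopic g := by
  -- The straight-line homotopy stays in the realization because each segment lies in a common face.
  refine ⟨⟨⟨fun p => ⟨(1 - (p.1 : ℝ)) • (f p.2).1 + (p.1 : ℝ) • (g p.2).1, ?_, ?_⟩, ?_⟩, ?_, ?_⟩⟩
  · exact convex_stdSimplex ℝ (Fin n) (f p.2).2.1 (g p.2).2.1 (sub_nonneg.2 p.1.2.2) p.1.2.1
      (by ring)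
  · obtain ⟨τ, hτ, h0⟩ := h p.2
    exact ⟨τ, hτ, fun i hi => by simp [h0 i hi]⟩
  · fun_prop
  · intro x
    ext i
    simp
  · intro x
    ext i
    simp

/-- A complex is contractible if a vertex map that is contiguous to the identity maps it into
the star of a vertex. -/
theorem isContractible_of_vertexMap (φ : Fin n → Fin n) (v : Fin n) (hK : ∅ ∈ K)
    (hφ : ∀ τ ∈ K, τ ∪ τ.image φ ∈ K) (hv : ∀ τ ∈ K, insert v (τ.image φ) ∈ K) :
    IsContractible K := by
  classical
  have hvK : {v} ∈ K := by simpa using hv ∅ hK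
  -- The simplicial map of `φ` in barycentric coordinates. It is homotopic first to the identity,
  -- then to the constant map at `v`.
  let F : (Fin n → ℝ) → Fin n → ℝ := fun x j => ∑ i with φ i = j, x i
  have hF0 : ∀ (x : Fin n → ℝ) (τ : Finset (Fin n)), (∀ i ∉ τ, x i = 0) →
      ∀ j ∉ τ.image φ, F x j = 0 := by
    intro x τ hx j hj
    refine Finset.sum_eq_zero fun i hi => hx i fun hiτ => hj ?_
    exact Finset.mem_image.2 ⟨i, hiτ, (Finset.mem_filter.1 hi).2⟩
  have hF : ∀ x ∈ realization K, F x ∈ realization K := by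
    rintro x ⟨⟨hx0, hx1⟩, τ, hτ, hτx⟩
    refine ⟨⟨fun j => Finset.sum_nonneg fun i _ => hx0 i, ?_⟩, τ.image φ,
      K.lower Finset.subset_union_right (hφ τ hτ), hF0 x τ hτx⟩
    rw [← hx1]
    exact Finset.sum_fiberwise Finset.univ φ x
  have hpt : Pi.single v 1 ∈ realization K :=
    ⟨single_mem_stdSimplex ℝ v, {v}, hvK, fun i hi => by
      simp [Finset.mem_singleton.not.1 hi]⟩
  let f : C(realization K, realization K) :=
    ⟨fun x => ⟨F x.1, hF x.1 x.2⟩, by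
      refine Continuous.subtype_mk ?_ _
      refine continuous_pi fun j => ?_
      fun_prop⟩
  rw [IsContractible, contractible_iff_id_nullhomotopic]
  refine ⟨⟨Pi.single v 1, hpt⟩, ContinuousMap.Homotopic.trans (g := f) ?_ ?_⟩
  · refine homotopic_of_common_face _ _ fun x => ?_
    obtain ⟨-, τ, hτ, hτx⟩ := x.2
    refine ⟨_, hφ τ hτ, fun i hi => ?_⟩
    rw [Finset.mem_union, not_or] at hi
    exact ⟨hτx i hi.1, hF0 x.1 τ hτx i hi.2⟩
  · refine homotopic_of_common_face _ _ fun x => ?_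
    obtain ⟨-, τ, hτ, hτx⟩ := x.2
    refine ⟨_, hv τ hτ, fun i hi => ?_⟩
    rw [Finset.mem_insert, not_or] at hi
    exact ⟨hF0 x.1 τ hτx i hi.2, by simp [hi.1]⟩

end Complexes

/-! ### Links of `C₀` at non-codewords -/

/-- The maximal codewords of `C₀`. -/
def facets : Finset (Finset (Fin 6)) :=
  {{2, 3, 4, 5}, {0, 1, 2}, {0, 3, 4}, {1, 4, 5}}

lemma mem_complex_C₀ {σ : Finset (Fin 6)} : σ ∈ complex C₀ ↔ ∃ c ∈ facets, σ ⊆ c := by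
  have h1 : ∀ c ∈ codewords, ∃ d ∈ facets, c ⊆ d := by decide
  have h2 : ∀ d ∈ facets, d ∈ codewords := by decide
  rw [complex, mem_lowerClosure]
  constructor
  · rintro ⟨c, hc, hσ⟩
    obtain ⟨d, hd, hcd⟩ := h1 c (mem_C₀.1 hc)
    exact ⟨d, hd, subset_trans hσ hcd⟩
  · rintro ⟨d, hd, hσ⟩
    exact ⟨d, mem_C₀.2 (h2 d hd), hσ⟩

lemma mem_link {n : ℕ} {K : LowerSet (Finset (Fin n))} {σ τ : Finset (Fin n)} :
    τ ∈ link K σ ↔ Disjoint τ σ ∧ τ ∪ σ ∈ K :=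
  Iff.rfl

-- The facets through `σ` intersect in a codeword unless that intersection is the neuron 5. So a
-- non-codeword `σ` other than this neuron is strictly smaller than the intersection, and any
-- additional vertex is an apex of the link.
set_option maxRecDepth 4000 in
lemma exists_apex : ∀ σ : Finset (Fin 6), (∃ c ∈ facets, σ ⊆ c) → σ ∉ codewords → σ ≠ {4} →
    ∃ v ∉ σ, ∀ c ∈ facets, σ ⊆ c → v ∈ c := by
  decide

/-- The links at non-codewords of `C₀` are cones, with one exception. -/
lemma exists_link_cone {σ : Finset (Fin 6)} (h : σ ∈ complex C₀) (hσ : σ ∉ C₀)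
    (h4 : σ ≠ {4}) :
    ∃ v, ∀ τ ∈ link (complex C₀) σ, insert v τ ∈ link (complex C₀) σ := by
  obtain ⟨v, hv, h⟩ := exists_apex σ (mem_complex_C₀.1 h) (mem_C₀.not.1 hσ) h4
  refine ⟨v, fun τ hτ => ?_⟩
  rw [mem_link, mem_complex_C₀] at hτ ⊢
  obtain ⟨hd, c, hc, hs⟩ := hτ
  refine ⟨Finset.disjoint_insert_left.2 ⟨hv, hd⟩, c, hc, ?_⟩
  rw [Finset.insert_union]
  exact Finset.insert_subset (h c hc (Finset.subset_union_right.trans hs)) hs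

/-- The facets of the link at the neuron 5. -/
def linkFacets : Finset (Finset (Fin 6)) :=
  {{2, 3, 5}, {0, 3}, {1, 5}}

lemma mem_link_four {τ : Finset (Fin 6)} :
    τ ∈ link (complex C₀) {4} ↔ ∃ c ∈ linkFacets, τ ⊆ c := by
  rw [mem_link, mem_complex_C₀]
  revert τ
  decide

lemma isContractible_link_four : IsContractible (link (complex C₀) {4}) := by
  -- The map folds the two attached edges onto the triangle, `0 ↦ 3` and `1 ↦ 5`, and fixes the
  -- triangle; the value at `4`, not a vertex of the link, is immaterial.
  refine isContractible_of_vertexMap ![3, 5, 2, 3, 4, 5] 3 ?_ ?_ ?_ <;>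
    simp only [mem_link_four] <;> decide

lemma isCollapsible_link_four : IsCollapsible (link (complex C₀) {4}) := by
  let K := link (complex C₀) {4}
  -- Removing the free ends `0` and `1` of the attached edges leaves a full triangle, a cone over
  -- any of its vertices.
  have hL : ∀ γ, γ ∈ deleteFace (deleteFace K {0}) {1} ↔ γ ⊆ {2, 3, 5} := by
    intro γ
    change ((γ ∈ K ∧ _) ∧ _) ↔ _
    rw [mem_link_four]
    revert γ
    decide
  have h1 : Collapses K (deleteFace K {0}) := by
    refine ⟨{0}, {0, 3}, by decide, by decide, mem_link_four.2 (by decide), ?_, rfl⟩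
    simp only [K, mem_link_four]
    decide
  have h2 : Collapses (deleteFace K {0}) (deleteFace (deleteFace K {0}) {1}) := by
    refine ⟨{1}, {1, 5}, by decide, by decide, ⟨mem_link_four.2 (by decide), by decide⟩, ?_, rfl⟩
    rintro γ ⟨hγ, -⟩
    rw [mem_link_four] at hγ
    revert γ
    decide
  obtain ⟨v, hv⟩ := isCollapsible_of_cone (K := deleteFace (deleteFace K {0}) {1}) (v := 3)
    ((hL _).2 (by decide)) (by simp only [hL]; decide)
  exact ⟨v, (hv.head h2).head h1⟩

lemma empty_mem_link {n : ℕ} {K : LowerSet (Finset (Fin n))} {σ : Finset (Fin n)} (hσ : σ ∈ K) :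
    ∅ ∈ link K σ :=
  mem_link.2 ⟨Finset.disjoint_empty_left σ, by rwa [Finset.empty_union]⟩

theorem isContractible_link_C₀ {σ : Finset (Fin 6)} (h : σ ∈ complex C₀) (hσ : σ ∉ C₀) :
    IsContractible (link (complex C₀) σ) := by
  by_cases h4 : σ = {4}
  · exact h4 ▸ isContractible_link_four
  · obtain ⟨v, hv⟩ := exists_link_cone h hσ h4
    exact isContractible_of_vertexMap id v (empty_mem_link h) (by simp) (by simpa using hv)

theorem isCollapsible_link_C₀ {σ : Finset (Fin 6)} (h : σ ∈ complex C₀) (hσ : σ ∉ C₀) :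
    IsCollapsible (link (complex C₀) σ) := by
  by_cases h4 : σ = {4}
  · exact h4 ▸ isCollapsible_link_four
  · obtain ⟨v, hv⟩ := exists_link_cone h hσ h4
    exact isCollapsible_of_cone (empty_mem_link h) hv

/-! ### Minimality of `C₀` -/

theorem almostRealizable_C₀ : ∀ i, AlmostRealizable C₀ i :=
  forall_fin_six.2 ⟨almostRealizable_zero, almostRealizable_one, almostRealizable_two,
    almostRealizable_three, almostRealizable_four, almostRealizable_five⟩

theorem isConvex_imageCode_C₀ {m : ℕ} {D : Code m} {f : C₀ → D} (hf : IsMorphism f)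
    (h : ¬ Isomorphic C₀ (imageCode f)) : IsConvex (imageCode f) := by
  obtain ⟨i, hi⟩ : ∃ i, ∀ j, f ⁻¹' trunk D {j} ≠ trunk C₀ {i} := by
    by_contra! h'
    exact h (isomorphic_imageCode hf h')
  exact (almostRealizable_C₀ i).isConvex_imageCode hf hi

/-- Since 1 and 2 are themselves codewords, a trunk that contains the trunks of both comes from the
empty set and is the whole code. For any other nonempty trunk, the realization up to neuron 1 or
that up to neuron 2 applies. -/
theorem isConvex_trunk_C₀ {T : Set C₀} (hT : IsTrunk T) (hne : T ≠ univ) :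
    IsConvex (Subtype.val '' T : Code 6) := by
  rcases hT with rfl | ⟨σ, rfl⟩
  · rw [image_empty]
    exact isConvex_empty
  by_cases h0 : trunk C₀ {0} ⊆ trunk C₀ σ
  · by_cases h1 : trunk C₀ {1} ⊆ trunk C₀ σ
    · refine absurd (eq_univ_of_forall fun c => ?_) hne
      have h2 : σ ⊆ {0} := @h0 ⟨{0}, mem_C₀.2 (by decide)⟩ (Finset.Subset.refl _)
      have h3 : σ ⊆ {1} := @h1 ⟨{1}, mem_C₀.2 (by decide)⟩ (Finset.Subset.refl _)
      have h4 : σ = ∅ := Finset.subset_empty.1 (Finset.subset_inter h2 h3)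
      rw [h4]
      exact Finset.empty_subset c.1
    · exact (almostRealizable_C₀ 1).isConvex_trunk h1
  · exact (almostRealizable_C₀ 0).isConvex_trunk h0

end NeuralCode


theorem theorem4 :
    NeuralCode.IsMinimallyNonConvex NeuralCode.C₀ ∧
    (∀ σ : Finset (Fin 6), ¬ NeuralCode.HasLocalObstructionAt NeuralCode.C₀ σ) ∧
    (∀ σ : Finset (Fin 6), ¬ NeuralCode.HasLocalObstructionOfSecondKindAt NeuralCode.C₀ σ) :=
  ⟨⟨NeuralCode.not_isConvex_C₀, fun _ _ _ hf h => NeuralCode.isConvex_imageCode_C₀ hf h,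
      fun _ hT hne => NeuralCode.isConvex_trunk_C₀ hT hne⟩,
    fun _ h => h.2.2 (NeuralCode.isContractible_link_C₀ h.1 h.2.1),
    fun _ h => h.2.2 (NeuralCode.isCollapsible_link_C₀ h.1 h.2.1)⟩
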